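/- **Theorem.** Let $\mathbb X$ be a standard Borel space with a metric $d$ inducing its Borel structure, let $\mathbb Y,\mathbb U$ be finite sets, and consider the partially observed Markov decision process with transition kernel $\mathcal T(dx'\mid x,u)$ on $\mathbb X$, observation channel $Q(dy\mid x)$ from $\mathbb X$ to $\mathbb Y$, stage cost $c:\mathbb X\times\mathbb U\to\mathbb R$ and discount factor $\beta\in(0,1)$. Assume that $c$ is continuous and bounded, and that there are constants $\alpha,K_1\ge 0$ with $$\|\mathcal T(\cdot\mid x,u)-\mathcal T(\cdot\mid x',u)\|_{TV}\le\alpha\,d(x,x'),\qquad |c(x,u)-c(x',u)|\le K_1\,d(x,x')\qquad(x,x'\in\mathbb X,\ u\in\mathbb U),$$ where $\|\mu-\nu\|_{TV}=2\sup_B|\mu(B)-\nu(B)|$. Let $W_1(\mu,\nu)=\sup\{\int f\,d\mu-\int f\,d\nu\}\in[0,\infty]$, the supremum being over the $1$-Lipschitz functions $f:\mathbb X\to\mathbb R$ integrable for $\mu$ and $\nu$ (all $1$-Lipschitz functions if $\mathbb X$ is compact). For $z\in\mathcal P(\mathbb X)$ let $P^z(X_n\in\cdot\mid y_{[0,n]},u_{[0,n-1]})$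 be the filter and $P^z(X_n\in\cdot\mid y_{[0,n-1]},u_{[0,n-1]})$ the predictor started from the prior $X_0\sim z$ (on observations of probability zero, a fixed version of the one-step conditional probability is used). Fix $N\ge 0$, $z_0^-,z^*\in\mathcal P(\mathbb X)$, and an admissible policy $\hat\gamma$ (actions $U_t$ are functions of $Y_{[0,t]},U_{[0,t-1]}$). Put $\hat z_t=(z_t^-,I_t^N)$ with $I_t^N=(Y_{[t,t+N]},U_{[t,t+N-1]})$ and $z_t^-$ the predictor of $X_t$ given $Y_{[0,t-1]},U_{[0,t-1]}$ when $X_0\sim z_0^-$. * $J^*_\beta$ is the optimal $\beta$-discounted cost of the finite window belief MDP with states $\hat z=(z,I)\in\mathcal P(\mathbb X)\times\mathbb Y^{N+1}\times\mathbb U^N$, stage cost $\hat c(\hat z,u)=\int c(x,u)\,P^z(X_N\in dx\mid I)$, and transitions as follows: after action $u$, a new observation $y$ is drawn from the conditional law of $Y_{N+1}$ given $I$ and $U_N=u$ under the prior $z$; the window $I$ is shifted by one; and $z$ is replaced by the predictor obtained from the oldest observation and action. * $\tilde J^N_\beta(z,I)=J^N_\beta(I)$, where $J^N_\beta$ is the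 optimal $\beta$-discounted cost of the finite MDP on the windows $I\in\mathbb Y^{N+1}\times\mathbb U^N$ with stage cost $\hat c((z^*,I),u)$ and with transition probabilities equal to the marginal on the windows of the transition probabilities from $(z^*,I)$ above. * $\hat\Gamma$ is the set of admissible policies which, at all times $t+N$ with $t\ge 0$, choose the action as a function of $(\hat z_t,t)$, and $$\bar L^N_t=\sup_{\hat\gamma'\in\hat\Gamma}E^{\hat\gamma'}_{z_0^-}\Big[W_1\Big(P^{z_t^-}\big(X_{t+N}\in\cdot\mid Y_{[t,t+N]},U_{[t,t+N-1]}\big),\,P^{z^*}\big(X_{t+N}\in\cdot\mid Y_{[t,t+N]},U_{[t,t+N-1]}\big)\Big)\Big].$$ Then, the expectation being over the random window $I_0^N=(Y_{[0,N]},U_{[0,N-1]})$ produced from $X_0\sim z_0^-$ by the policy $\hat\gamma$ acting on the first $N$ steps, $$E^{\hat\gamma}_{z_0^-}\Big[\big|\tilde J^N_\beta(z_0^-,I_0^N)-J^*_\beta(z_0^-,I_0^N)\big|\Big]\le\Big(K_1+\alpha\beta\frac{\|c\|_\infty}{1-\beta}\Big)\sum_{t=0}^\infty\beta^t\,\bar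 L^N_t .$$ -/

import Mathlib

open MeasureTheory ProbabilityTheory
open scoped ENNReal BoundedContinuousFunction

noncomputable section

/-! ### Distances between probability measures -/

/-- The total variation metric `‖μ - ν‖_TV = 2 sup_B |μ(B) - ν(B)|`. -/
def tvDist {S : Type*} [MeasurableSpace S] (μ ν : Measure S) : ℝ :=
  2 * ⨆ B : {B : Set S // MeasurableSet B}, |μ.real B.1 - ν.real B.1|

/-- The Kantorovich-Rubinstein (Wasserstein-1) metric, with values in `[0, ∞]`: the supremum of
`∫ f dμ - ∫ f dν` over the 1-Lipschitz `f`. On a bounded (in particular compact) space the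
integrability clause holds for every Lipschitz `f` and the value is finite. -/
def wasserstein1 {S : Type*} [MetricSpace S] [MeasurableSpace S] (μ ν : Measure S) : ℝ≥0∞ :=
  ⨆ f : {f : S → ℝ // LipschitzWith 1 f ∧ Integrable f μ ∧ Integrable f ν},
    ENNReal.ofReal (∫ x, f.1 x ∂μ - ∫ x, f.1 x ∂ν)

/-! ### Histories and deterministic history-dependent policies -/

/-- A history of length `n`: the values `y_0, …, y_n` and the actions `u_0, …, u_{n-1}`. -/
abbrev Hist (Y U : Type*) (n : ℕ) : Type _ := (Fin (n + 1) → Y) × (Fin n → U)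

/-- Extend a history by the action taken now and the next value. -/
def Hist.snoc {Y U : Type*} {n : ℕ} (h : Hist Y U n) (u : U) (y : Y) : Hist Y U (n + 1) :=
  (Fin.snoc h.1 y, Fin.snoc h.2 u)

/-- A policy chooses the action at time `n` as a function of the history up to time `n`. -/
abbrev Policy (Y U : Type*) : Type _ := ∀ n, Hist Y U n → U

/-! ### Discounted Markov decision processes with discrete transition probabilities -/

/-- A Markov decision process with states `S` and actions `U`; the next state has a discrete
distribution (the state space itself may be uncountable). -/
structure MDP (S U : Type*) where
  /-- one-stage cost -/
  cost : S → U → ℝ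
  /-- transition probabilities -/
  trans : S → U → PMF S

namespace MDP

variable {S U : Type*} (M : MDP S U)

/-- The law of the history `(s_0, …, s_n, u_0, …, u_{n-1})` started from `s` under `π`. -/
def law (s : S) (π : Policy S U) : (n : ℕ) → PMF (Hist S U n)
  | 0 => PMF.pure (fun _ => s, Fin.elim0)
  | n + 1 => (law s π n).bind fun h =>
      (M.trans (h.1 (Fin.last n)) (π n h)).map fun s' => Hist.snoc h (π n h) s'

/-- The expected cost `E_s^π[c(s_n, u_n)]` at time `n`. -/
def stageCost (s : S) (π : Policy S U) (n : ℕ) : ℝ :=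
  ∑' h : Hist S U n, (M.law s π n h).toReal * M.cost (h.1 (Fin.last n)) (π n h)

/-- The discounted cost `∑ βⁿ E_s^π[c(s_n, u_n)]`. -/
def discountedCost (β : ℝ) (s : S) (π : Policy S U) : ℝ :=
  ∑' n : ℕ, β ^ n * M.stageCost s π n

/-- The optimal value function. -/
def value (β : ℝ) (s : S) : ℝ := ⨅ π : Policy S U, M.discountedCost β s π

end MDP

/-! ### Partially observed models -/

/-- A partially observed Markov decision process: transition kernel `T(dx' | x, u)`, observation
channel `Q(dy | x)` and a bounded continuous stage cost. -/
structure POMDP (X Y U : Type*) [TopologicalSpace X] [MeasurableSpace X] [MeasurableSpace Y]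
    [TopologicalSpace U] [MeasurableSpace U] where
  /-- transition kernel -/
  T : Kernel (X × U) X
  /-- observation channel -/
  Q : Kernel X Y
  /-- stage cost -/
  c : (X × U) →ᵇ ℝ
  markovT : IsMarkovKernel T
  markovQ : IsMarkovKernel Q

attribute [instance] POMDP.markovT POMDP.markovQ

namespace POMDP

variable {X Y U : Type*} [MetricSpace X] [MeasurableSpace X]
  [Finite Y] [MeasurableSpace Y] [MeasurableSingletonClass Y]
  [Finite U] [TopologicalSpace U] [MeasurableSpace U] [MeasurableSingletonClass U]
  (P : POMDP X Y U)

/-- Given `(x_n, h)`, the conditional law of `(X_{n+1}, Y_{n+1})` under the policy `γ`: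
`X_{n+1} ∼ T(· | x_n, γ_n(h))` and then `Y_{n+1} ∼ Q(· | X_{n+1})`. -/
def step (γ : Policy Y U) (n : ℕ) : Kernel (X × Hist Y U n) (X × Y) :=
  (P.T.comap (fun p : X × Hist Y U n => (p.1, γ n p.2))
      (measurable_fst.prodMk ((measurable_of_finite (γ n)).comp measurable_snd))) ⊗ₖ
    Kernel.prodMkLeft (X × Hist Y U n) P.Q

instance (γ : Policy Y U) (n : ℕ) : IsMarkovKernel (P.step γ n) := by
  unfold step; infer_instance

/-- The joint law of `X_n` and of the information `(Y_0, …, Y_n, U_0, …, U_{n-1})` when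
`X_0 ∼ μ` and the admissible policy `γ` is used. -/
def law (μ : ProbabilityMeasure X) (γ : Policy Y U) : (n : ℕ) → Measure (X × Hist Y U n)
  | 0 => ((μ : Measure X) ⊗ₘ P.Q).map fun p => (p.1, (fun _ => p.2, Fin.elim0))
  | n + 1 => (law μ γ n ⊗ₘ P.step γ n).map fun p =>
      (p.2.1, Hist.snoc p.1.2 (γ n p.1.2) p.2.2)

instance (μ : ProbabilityMeasure X) (γ : Policy Y U) (n : ℕ) :
    IsProbabilityMeasure (P.law μ γ n) := by
  induction n with
  | zero =>
    refine Measure.isProbabilityMeasure_map (Measurable.aemeasurable ?_)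
    exact measurable_fst.prodMk
      ((measurable_of_finite (fun y : Y => ((fun _ => y, Fin.elim0) : Hist Y U 0))).comp
        measurable_snd)
  | succ n ih =>
    refine Measure.isProbabilityMeasure_map (Measurable.aemeasurable ?_)
    refine (measurable_fst.comp measurable_snd).prodMk ?_
    exact (measurable_of_finite
      (fun q : Hist Y U n × Y => Hist.snoc q.1 (γ n q.1) q.2)).comp
      ((measurable_snd.comp measurable_fst).prodMk (measurable_snd.comp measurable_snd))

/-- Prediction step: the law of `X_{n+1}` when `X_n ∼ z` and `U_n = u`. -/
def predict (z : ProbabilityMeasure X) (u : U) : ProbabilityMeasure X :=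
  ⟨(P.T.sectL u) ∘ₘ (z : Measure X), inferInstance⟩

/-- The law of the next observation when `X_n ∼ z` and `U_n = u`. -/
def obsPMF (z : ProbabilityMeasure X) (u : U) : PMF Y :=
  (P.Q ∘ₘ (P.predict z u : Measure X)).toPMF

variable [StandardBorelSpace X] [Nonempty X]

/-- Bayes update: the conditional law of `X` given `Y = y` when `X ∼ z` and `Y ∼ Q(· | X)`. -/
def update (z : ProbabilityMeasure X) (y : Y) : ProbabilityMeasure X :=
  ⟨posterior P.Q (z : Measure X) y, inferInstance⟩

/-- The predictor `P^z(X_n ∈ · | y_0, …, y_{n-1}, u_0, …, u_{n-1})`. -/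
def predictor (z : ProbabilityMeasure X) :
    (n : ℕ) → (Fin n → Y) → (Fin n → U) → ProbabilityMeasure X
  | 0, _, _ => z
  | n + 1, y, u =>
      P.predict (P.update (predictor z n (Fin.init y) (Fin.init u)) (y (Fin.last n)))
        (u (Fin.last n))

/-- The filter `P^z(X_n ∈ · | y_0, …, y_n, u_0, …, u_{n-1})`. -/
def filter (z : ProbabilityMeasure X) {n : ℕ} (h : Hist Y U n) : ProbabilityMeasure X :=
  P.update (P.predictor z n (Fin.init h.1) h.2) (h.1 (Fin.last n))

/-! ### The finite window reduction -/

/-- The last `N + 1` observations and `N` actions of a history of length `t + N`, that is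
`y_t, …, y_{t+N}` and `u_t, …, u_{t+N-1}`. -/
def window {t N : ℕ} (h : Hist Y U (t + N)) : Hist Y U N :=
  (fun i => h.1 (Fin.natAdd t i), fun i => h.2 (Fin.natAdd t i))

/-- The predictor `z_t^-` computed from the first `t` observations and actions of a history of
length `t + N`, when `X_0 ∼ z`. -/
def pastPredictor (z : ProbabilityMeasure X) {t N : ℕ} (h : Hist Y U (t + N)) :
    ProbabilityMeasure X :=
  P.predictor z t (fun i => h.1 (Fin.castAdd (N + 1) i)) (fun i => h.2 (Fin.castAdd N i))

/-- The state `(z_t^-, (y_t, …, y_{t+N}, u_t, …, u_{t+N-1}))` of the reduction. -/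
def zhat (z : ProbabilityMeasure X) {t N : ℕ} (h : Hist Y U (t + N)) :
    ProbabilityMeasure X × Hist Y U N :=
  (P.pastPredictor z h, window h)

/-- The successor of the state `(z, I)` after the action `u` and the observation `y`: the window
moves by one and the predictor is advanced with the oldest observation and action. -/
def nextState {N : ℕ} (s : ProbabilityMeasure X × Hist Y U N) (u : U) (y : Y) :
    ProbabilityMeasure X × Hist Y U N :=
  let h : Hist Y U (N + 1) := Hist.snoc s.2 u y
  (P.predict (P.update s.1 (h.1 0)) (h.2 0), (Fin.tail h.1, Fin.tail h.2))

/-- The finite window belief MDP on the states `(z, I)`, with cost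
`∫ c(x, u) P^z(dx | I)` and the transitions given by the next observation. -/
def windowMDP (N : ℕ) : MDP (ProbabilityMeasure X × Hist Y U N) U where
  cost s u := ∫ x, P.c (x, u) ∂(P.filter s.1 s.2 : Measure X)
  trans s u := (P.obsPMF (P.filter s.1 s.2) u).map (P.nextState s u)

/-- The approximate MDP on the finite set of windows: the predictor in the state is always
replaced by `zstar`. -/
def approxMDP (zstar : ProbabilityMeasure X) (N : ℕ) : MDP (Hist Y U N) U where
  cost I u := (P.windowMDP N).cost (zstar, I) u
  trans I u := ((P.windowMDP N).trans (zstar, I) u).map Prod.snd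

/-- The true optimal value `J*_β` at a state of the finite window belief MDP. -/
def Jstar (β : ℝ) {N : ℕ} (s : ProbabilityMeasure X × Hist Y U N) : ℝ :=
  (P.windowMDP N).value β s

/-- The optimal value of the approximate MDP, extended to all states by ignoring the predictor. -/
def Jtilde (β : ℝ) (zstar : ProbabilityMeasure X) {N : ℕ}
    (s : ProbabilityMeasure X × Hist Y U N) : ℝ :=
  (P.approxMDP zstar N).value β s.2

/-- The admissible policies which, from time `N` on, depend on the history only through time and
the state `zhat` of the reduction, when `X_0 ∼ z`. (Only finitely many states `zhat` can occur
at a given time, so that measurability of `g` is no restriction.) -/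
def markovPolicies (z : ProbabilityMeasure X) (N : ℕ) : Set (Policy Y U) :=
  {γ | ∀ t : ℕ, ∃ g : ProbabilityMeasure X × Hist Y U N → U,
    ∀ h : Hist Y U (t + N), γ (t + N) h = g (P.zhat z h)}

/-- The filter stability term: the supremum over these policies of the expected Wasserstein
distance, at time `t + N`, between the filters started at time `t` from the true predictor
`z_t^-` and from `zstar`. -/
def Lbar (z zstar : ProbabilityMeasure X) (N t : ℕ) : ℝ≥0∞ :=
  ⨆ γ ∈ P.markovPolicies z N, ∫⁻ p : X × Hist Y U (t + N),
    wasserstein1 (P.filter (P.pastPredictor z p.2) (window p.2) : Measure X)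
      (P.filter zstar (window p.2) : Measure X) ∂(P.law z γ (t + N))

end POMDP

end

noncomputable section

set_option linter.unusedSectionVars false

/-! Write D(s) for the gap between the two value functions at s = (z, I), and w(s) for the W₁
distance between the filters that the window I produces from z and from `zstar`. Both values are
bounded by M = ‖c‖/(1-β) and solve Bellman equations over the same finite action set
(`MDP.value_eq_iInf`), so the gap of the two minima is at most the gap of the two objectives at one
action u = g(s).

At that action the stage costs differ by at most K₁ w(s). For the continuation, the observation law
is changed while `Jtilde` is integrated: its window update ignores the predictor, so the integrand
is the same under both laws. Total variation regularity of T makes the expected continuation an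
αM-Lipschitz function of the current hidden state, which costs αβM w(s). What remains is β times the
mean of D at the successor, under the true observation law. Hence D ≤ (K₁ + αβM) w + β E[D(next)],
which is `exists_ofReal_abs_Jtilde_sub_Jstar_le`.

The selector g defines one policy: follow γ up to time N, then apply g to the reduced state. Since
the filter is the true conditional law (`lintegral_law_filter`) and restarting it from z_t^- loses
nothing (`filter_zhat`), the reduced state under this policy moves exactly as in the recursion. The
policy is admissible in every supremum `Lbar`, so integrating and iterating gives the series; the
remainder βⁿ E[D] vanishes because D is bounded. -/

/-! ### Expectations of bounded functions under discrete distributions -/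

namespace PMF

variable {A B : Type*}

/-- The expectation of a real function under a discrete distribution. -/
def expect (p : PMF A) (f : A → ℝ) : ℝ := ∑' a, (p a).toReal * f a

theorem hasSum_toReal (p : PMF A) : HasSum (fun a => (p a).toReal) 1 := by
  have h := ENNReal.hasSum_toReal (f := fun a => p a) (by rw [p.tsum_coe]; exact ENNReal.one_ne_top)
  rwa [← ENNReal.tsum_toReal_eq (fun a => p.apply_ne_top a), p.tsum_coe, ENNReal.toReal_one] at h

theorem summable_toReal_mul (p : PMF A) {f : A → ℝ} {C : ℝ} (hf : ∀ a, |f a| ≤ C) :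
    Summable fun a => (p a).toReal * f a := by
  refine Summable.of_norm_bounded (p.hasSum_toReal.summable.mul_right C) fun a => ?_
  rw [Real.norm_eq_abs, abs_mul, abs_of_nonneg ENNReal.toReal_nonneg]
  exact mul_le_mul_of_nonneg_left (hf a) ENNReal.toReal_nonneg

theorem expect_const (p : PMF A) (C : ℝ) : p.expect (fun _ => C) = C := by
  simp [expect, tsum_mul_right, p.hasSum_toReal.tsum_eq]

theorem expect_mono (p : PMF A) {f g : A → ℝ} {C D : ℝ} (hf : ∀ a, |f a| ≤ C)
    (hg : ∀ a, |g a| ≤ D) (h : ∀ a, f a ≤ g a) : p.expect f ≤ p.expect g :=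
  (p.summable_toReal_mul hf).tsum_le_tsum
    (fun a => mul_le_mul_of_nonneg_left (h a) ENNReal.toReal_nonneg) (p.summable_toReal_mul hg)

theorem expect_add (p : PMF A) {f g : A → ℝ} {C D : ℝ} (hf : ∀ a, |f a| ≤ C)
    (hg : ∀ a, |g a| ≤ D) : p.expect (fun a => f a + g a) = p.expect f + p.expect g := by
  simp only [expect, mul_add]
  exact (p.summable_toReal_mul hf).tsum_add (p.summable_toReal_mul hg)

theorem expect_sub (p : PMF A) {f g : A → ℝ} {C D : ℝ} (hf : ∀ a, |f a| ≤ C)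
    (hg : ∀ a, |g a| ≤ D) : p.expect (fun a => f a - g a) = p.expect f - p.expect g := by
  simp only [expect, mul_sub]
  exact (p.summable_toReal_mul hf).tsum_sub (p.summable_toReal_mul hg)

theorem expect_const_mul (p : PMF A) (b : ℝ) (f : A → ℝ) :
    p.expect (fun a => b * f a) = b * p.expect f := by
  simp only [expect, ← tsum_mul_left]
  exact tsum_congr fun a => by ring

theorem abs_expect_le (p : PMF A) {f : A → ℝ} {C : ℝ} (hf : ∀ a, |f a| ≤ C) :
    |p.expect f| ≤ C := by
  have hC : ∀ c : ℝ, ∀ _ : A, |c| ≤ |c| := fun _ _ => le_rfl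
  refine abs_le.2 ⟨?_, ?_⟩
  · rw [← p.expect_const (-C)]
    exact p.expect_mono (hC _) hf fun a => (abs_le.1 (hf a)).1
  · rw [← p.expect_const C]
    exact p.expect_mono hf (hC _) fun a => (abs_le.1 (hf a)).2

theorem expect_pure (a : A) (f : A → ℝ) : (PMF.pure a).expect f = f a := by
  rw [expect, tsum_eq_single a]
  · simp
  · intro b hb
    simp [PMF.pure_apply, hb]

theorem expect_bind (p : PMF A) (q : A → PMF B) {f : B → ℝ} {C : ℝ} (hf : ∀ b, |f b| ≤ C) :
    (p.bind q).expect f = p.expect fun a => (q a).expect f := by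
  have hs : Summable fun x : A × B => (p x.1).toReal * (q x.1 x.2).toReal := by
    have h0 : 0 ≤ fun x : A × B => (p x.1).toReal * (q x.1 x.2).toReal := fun _ =>
      mul_nonneg ENNReal.toReal_nonneg ENNReal.toReal_nonneg
    refine (summable_prod_of_nonneg h0).2 ⟨fun a => ?_, ?_⟩
    · exact Summable.mul_left (p a).toReal (q a).hasSum_toReal.summable
    · have h1 : (fun a => ∑' b, (p a).toReal * (q a b).toReal) = fun a => (p a).toReal := by
        ext a
        rw [tsum_mul_left, (q a).hasSum_toReal.tsum_eq, mul_one]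
      change Summable fun a => ∑' b, (p a).toReal * (q a b).toReal
      rw [h1]
      exact p.hasSum_toReal.summable
  have hsf : Summable fun x : A × B => (p x.1).toReal * (q x.1 x.2).toReal * f x.2 := by
    refine Summable.of_norm_bounded (hs.mul_right C) fun x => ?_
    rw [Real.norm_eq_abs, abs_mul, abs_of_nonneg (by positivity)]
    exact mul_le_mul_of_nonneg_left (hf x.2) (by positivity)
  calc (p.bind q).expect f
      = ∑' b, ∑' a, (p a).toReal * (q a b).toReal * f b := by
        refine tsum_congr fun b => ?_
        rw [tsum_mul_right, PMF.bind_apply, ENNReal.tsum_toReal_eq]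
        · simp only [ENNReal.toReal_mul]
        · exact fun a => ENNReal.mul_ne_top (p.apply_ne_top a) ((q a).apply_ne_top b)
    _ = ∑' a, ∑' b, (p a).toReal * (q a b).toReal * f b :=
        Summable.tsum_comm (f := fun a b => (p a).toReal * (q a b).toReal * f b) hsf
    _ = _ := by
        refine tsum_congr fun a => ?_
        simp only [mul_assoc, tsum_mul_left, expect]

theorem expect_map (p : PMF A) (q : A → B) {f : B → ℝ} {C : ℝ} (hf : ∀ b, |f b| ≤ C) :
    (p.map q).expect f = p.expect fun a => f (q a) := by
  rw [← PMF.bind_pure_comp, expect_bind p _ hf]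
  simp only [Function.comp, expect_pure]

end PMF

/-! ### The Bellman equation -/

/-- Take the minimiser of the function with the smaller infimum. Having a single index, instead of a
maximum over indices, is what later lets one action per state, hence one policy, carry the whole
estimate. -/
theorem exists_abs_ciInf_sub_ciInf_le {ι : Type*} [Finite ι] [Nonempty ι] (f g : ι → ℝ) :
    ∃ i, |(⨅ i, f i) - ⨅ i, g i| ≤ |f i - g i| := by
  obtain ⟨i, hi⟩ := exists_eq_ciInf_of_finite (f := f)
  obtain ⟨j, hj⟩ := exists_eq_ciInf_of_finite (f := g)
  have h1 := ciInf_le (Set.finite_range f).bddBelow j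
  have h2 := ciInf_le (Set.finite_range g).bddBelow i
  rw [← hi] at h1 ⊢
  rw [← hj] at h2 ⊢
  rcases le_total (f i) (g j) with h | h
  · refine ⟨i, ?_⟩
    rw [abs_sub_comm, abs_of_nonneg (by linarith), abs_sub_comm, abs_of_nonneg (by linarith)]
    linarith
  · refine ⟨j, ?_⟩
    rw [abs_of_nonneg (by linarith), abs_of_nonneg (by linarith)]
    linarith

namespace MDP

variable {S U : Type*} (M : MDP S U)

/-- The right-hand side of the Bellman equation for a fixed action. -/
def actionValue (β : ℝ) (f : S → ℝ) (s : S) (u : U) : ℝ :=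
  M.cost s u + β * (M.trans s u).expect f

theorem exists_bellman_fixedPoint [Finite U] [Nonempty U] {β C : ℝ} (hβ0 : 0 ≤ β) (hβ1 : β < 1)
    (hC : ∀ s u, |M.cost s u| ≤ C) :
    ∃ W : S → ℝ, (∃ D, ∀ s, |W s| ≤ D) ∧ ∀ s, W s = ⨅ u, M.actionValue β W s u := by
  -- With the discrete topology every bounded function on S is continuous, so Banach's fixed point
  -- theorem applies in the complete space `S →ᵇ ℝ`.
  let _ : TopologicalSpace S := ⊥
  have : DiscreteTopology S := ⟨rfl⟩
  have hb (f : S →ᵇ ℝ) (s : S) : |f s| ≤ ‖f‖ := f.norm_coe_le_norm s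
  have hbd (f : S →ᵇ ℝ) (s : S) : |⨅ u, M.actionValue β f s u| ≤ C + β * ‖f‖ := by
    obtain ⟨u, hu⟩ := exists_eq_ciInf_of_finite (f := fun u => M.actionValue β f s u)
    rw [← hu, actionValue]
    refine (abs_add_le _ _).trans (add_le_add (hC s u) ?_)
    rw [abs_mul, abs_of_nonneg hβ0]
    exact mul_le_mul_of_nonneg_left (PMF.abs_expect_le _ (hb f)) hβ0
  let T : (S →ᵇ ℝ) → (S →ᵇ ℝ) := fun f =>
    BoundedContinuousFunction.ofNormedAddCommGroup (fun s => ⨅ u, M.actionValue β f s u)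
      continuous_of_discreteTopology (C + β * ‖f‖) (hbd f)
  have hT : ContractingWith ⟨β, hβ0⟩ T := by
    refine ⟨by exact_mod_cast hβ1, LipschitzWith.of_dist_le_mul fun f g => ?_⟩
    refine (BoundedContinuousFunction.dist_le (mul_nonneg hβ0 dist_nonneg)).2 fun s => ?_
    obtain ⟨u, hu⟩ := exists_abs_ciInf_sub_ciInf_le (fun u => M.actionValue β f s u)
      (fun u => M.actionValue β g s u)
    refine (show dist (T f s) (T g s) ≤ _ from hu).trans ?_
    have : M.actionValue β f s u - M.actionValue β g s u
        = β * (M.trans s u).expect (fun s => f s - g s) := by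
      rw [PMF.expect_sub _ (hb f) (hb g), actionValue, actionValue]; ring
    rw [this, abs_mul, abs_of_nonneg hβ0]
    exact mul_le_mul_of_nonneg_left
      (PMF.abs_expect_le _ fun s =>
        (BoundedContinuousFunction.dist_coe_le_dist (f := f) (g := g) s :)) hβ0
  let W : S →ᵇ ℝ := ContractingWith.fixedPoint T hT
  refine ⟨W, ⟨_, hb W⟩, fun s => ?_⟩
  exact (congrArg (fun f : S →ᵇ ℝ => f s) hT.fixedPoint_isFixedPt.eq).symm

theorem stageCost_eq_expect (s : S) (π : Policy S U) (n : ℕ) :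
    M.stageCost s π n = (M.law s π n).expect fun h => M.cost (h.1 (Fin.last n)) (π n h) := rfl

theorem abs_stageCost_le {C : ℝ} (hC : ∀ s u, |M.cost s u| ≤ C) (s : S) (π : Policy S U) (n : ℕ) :
    |M.stageCost s π n| ≤ C :=
  PMF.abs_expect_le _ fun _ => hC _ _

theorem expect_law_succ (s : S) (π : Policy S U) (n : ℕ) {W : S → ℝ} {D : ℝ}
    (hW : ∀ s, |W s| ≤ D) :
    (M.law s π (n + 1)).expect (fun h => W (h.1 (Fin.last (n + 1))))
      = (M.law s π n).expect fun h => (M.trans (h.1 (Fin.last n)) (π n h)).expect W := by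
  rw [law, PMF.expect_bind (C := D) _ _ fun _ => hW _]
  congr 1
  ext h
  rw [PMF.expect_map (C := D) _ _ fun _ => hW _]
  simp [Hist.snoc]

theorem summable_discounted {β C : ℝ} (hβ0 : 0 ≤ β) (hβ1 : β < 1)
    (hC : ∀ s u, |M.cost s u| ≤ C) (s : S) (π : Policy S U) :
    Summable fun n : ℕ => β ^ n * M.stageCost s π n := by
  refine Summable.of_norm_bounded ((summable_geometric_of_lt_one hβ0 hβ1).mul_right C) fun n => ?_
  rw [Real.norm_eq_abs, abs_mul, abs_of_nonneg (pow_nonneg hβ0 n)]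
  exact mul_le_mul_of_nonneg_left (M.abs_stageCost_le hC s π n) (pow_nonneg hβ0 n)

theorem abs_discountedCost_le {β C : ℝ} (hβ0 : 0 ≤ β) (hβ1 : β < 1)
    (hC : ∀ s u, |M.cost s u| ≤ C) (s : S) (π : Policy S U) :
    |M.discountedCost β s π| ≤ C / (1 - β) := by
  have h := tsum_of_norm_bounded (f := fun n : ℕ => β ^ n * M.stageCost s π n)
    ((hasSum_geometric_of_lt_one hβ0 hβ1).mul_right C) fun n => by
      rw [Real.norm_eq_abs, abs_mul, abs_of_nonneg (pow_nonneg hβ0 n)]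
      exact mul_le_mul_of_nonneg_left (M.abs_stageCost_le hC s π n) (pow_nonneg hβ0 n)
  rwa [inv_mul_eq_div] at h

theorem abs_value_le [Nonempty U] {β C : ℝ} (hβ0 : 0 ≤ β) (hβ1 : β < 1)
    (hC : ∀ s u, |M.cost s u| ≤ C) (s : S) : |M.value β s| ≤ C / (1 - β) := by
  have : Nonempty (Policy S U) := ⟨fun _ _ => Classical.arbitrary U⟩
  have h := fun π => abs_le.1 (M.abs_discountedCost_le hβ0 hβ1 hC s π)
  have hb : BddBelow (Set.range fun π => M.discountedCost β s π) :=
    ⟨_, by rintro _ ⟨π, rfl⟩; exact (h π).1⟩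
  exact abs_le.2 ⟨le_ciInf fun π => (h π).1,
    (ciInf_le hb (Classical.arbitrary _)).trans (h _).2⟩

/-- The discounted cost of a policy minus `W s` is the discounted sum of the Bellman gaps of `W`. -/
theorem hasSum_bellman_gap {β C D : ℝ} (hβ0 : 0 ≤ β) (hβ1 : β < 1)
    (hC : ∀ s u, |M.cost s u| ≤ C) {W : S → ℝ} (hW : ∀ s, |W s| ≤ D) (s : S) (π : Policy S U) :
    HasSum (fun n => β ^ n * (M.law s π n).expect fun h =>
        M.actionValue β W (h.1 (Fin.last n)) (π n h) - W (h.1 (Fin.last n)))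
      (M.discountedCost β s π - W s) := by
  -- The n-th discounted gap is the discounted stage cost plus e (n + 1) - e n; the increments
  -- telescope to -e 0 = -W s because e tends to 0.
  set e : ℕ → ℝ := fun n => β ^ n * (M.law s π n).expect fun h => W (h.1 (Fin.last n)) with he
  have hterm : ∀ n, (β ^ n * (M.law s π n).expect fun h =>
      M.actionValue β W (h.1 (Fin.last n)) (π n h) - W (h.1 (Fin.last n)))
        = β ^ n * M.stageCost s π n + (e (n + 1) - e n) := by
    intro n
    have h1 : ∀ h : Hist S U n,
        |β * (M.trans (h.1 (Fin.last n)) (π n h)).expect W| ≤ β * D := fun h => by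
      rw [abs_mul, abs_of_nonneg hβ0]
      exact mul_le_mul_of_nonneg_left (PMF.abs_expect_le _ hW) hβ0
    have h2 : ∀ h : Hist S U n, |M.actionValue β W (h.1 (Fin.last n)) (π n h)| ≤ C + β * D :=
      fun h => (abs_add_le _ _).trans (add_le_add (hC _ _) (h1 h))
    rw [PMF.expect_sub _ h2 fun _ => hW _]
    simp only [actionValue, he]
    rw [PMF.expect_add _ (fun _ => hC _ _) h1, PMF.expect_const_mul, ← expect_law_succ _ _ _ _ hW,
      stageCost_eq_expect]
    ring
  have hlim : Filter.Tendsto e Filter.atTop (nhds 0) := by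
    refine squeeze_zero_norm (a := fun n => β ^ n * D) (fun n => ?_) ?_
    · rw [Real.norm_eq_abs, abs_mul, abs_of_nonneg (pow_nonneg hβ0 n)]
      exact mul_le_mul_of_nonneg_left (PMF.abs_expect_le _ fun _ => hW _) (pow_nonneg hβ0 n)
    · simpa using (tendsto_pow_atTop_nhds_zero_of_lt_one hβ0 hβ1).mul_const D
  have hsum : Summable e := by
    refine Summable.of_norm_bounded ((summable_geometric_of_lt_one hβ0 hβ1).mul_right D)
      fun n => ?_
    rw [Real.norm_eq_abs, abs_mul, abs_of_nonneg (pow_nonneg hβ0 n)]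
    exact mul_le_mul_of_nonneg_left (PMF.abs_expect_le _ fun _ => hW _) (pow_nonneg hβ0 n)
  have he0 : e 0 = W s := by
    simp only [he, pow_zero, one_mul, law]
    exact PMF.expect_pure _ _
  have htel : HasSum (fun n => e (n + 1) - e n) (-W s) := by
    have hs1 : Summable fun n => e (n + 1) := (summable_nat_add_iff 1).2 hsum
    have := hs1.hasSum.sub hsum.hasSum
    rwa [hsum.tsum_eq_zero_add, he0, sub_add_cancel_right] at this
  simp only [hterm, sub_eq_add_neg (M.discountedCost β s π)]
  exact (M.summable_discounted hβ0 hβ1 hC s π).hasSum.add htel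

/-- The Bellman equation for the optimal value over all history-dependent policies. -/
theorem value_eq_iInf [Finite U] [Nonempty U] {β C : ℝ} (hβ0 : 0 ≤ β) (hβ1 : β < 1)
    (hC : ∀ s u, |M.cost s u| ≤ C) (s : S) :
    M.value β s = ⨅ u, M.actionValue β (M.value β) s u := by
  obtain ⟨W, ⟨D, hD⟩, hW⟩ := M.exists_bellman_fixedPoint hβ0 hβ1 hC
  suffices h : M.value β = W by rw [h]; exact hW s
  ext s
  have hle : ∀ s u, W s ≤ M.actionValue β W s u := fun s u => by
    conv_lhs => rw [hW s]
    exact ciInf_le (Set.finite_range _).bddBelow u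
  -- A greedy selector has zero Bellman gap at every time, so its cost is exactly W s, while
  -- nonnegative gaps bound every other policy from below.
  choose g hg using fun s => exists_eq_ciInf_of_finite (f := fun u => M.actionValue β W s u)
  have : Nonempty (Policy S U) := ⟨fun _ _ => Classical.arbitrary U⟩
  have hlow : ∀ π, W s ≤ M.discountedCost β s π := fun π => by
    refine sub_nonneg.1 ((M.hasSum_bellman_gap hβ0 hβ1 hC hD s π).nonneg fun n => ?_)
    exact mul_nonneg (pow_nonneg hβ0 n)
      (tsum_nonneg fun h => mul_nonneg ENNReal.toReal_nonneg (sub_nonneg.2 (hle _ _)))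
  refine le_antisymm ?_ (le_ciInf hlow)
  have hopt := M.hasSum_bellman_gap hβ0 hβ1 hC hD s (fun n h => g (h.1 (Fin.last n)))
  simp only [hg, ← hW, sub_self, PMF.expect_const, mul_zero] at hopt
  rw [← sub_eq_zero.1 (hopt.unique hasSum_zero)]
  exact ciInf_le ⟨W s, by rintro _ ⟨π, rfl⟩; exact hlow π⟩ _

end MDP

/-! ### Integrals of bounded and of Lipschitz functions -/

theorem abs_real_sub_le_tvDist {S : Type*} [MeasurableSpace S] (μ ν : Measure S)
    [IsProbabilityMeasure μ] [IsProbabilityMeasure ν] {B : Set S} (hB : MeasurableSet B) :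
    2 * |μ.real B - ν.real B| ≤ tvDist μ ν := by
  refine mul_le_mul_of_nonneg_left ?_ zero_le_two
  refine le_ciSup (f := fun B : {B : Set S // MeasurableSet B} => |μ.real B.1 - ν.real B.1|)
    ⟨1, ?_⟩ ⟨B, hB⟩
  rintro _ ⟨A, rfl⟩
  have h1 := measureReal_nonneg (μ := μ) (s := A.1)
  have h2 := measureReal_nonneg (μ := ν) (s := A.1)
  have h3 := measureReal_le_one (μ := μ) (s := A.1)
  have h4 := measureReal_le_one (μ := ν) (s := A.1)
  exact abs_le.2 ⟨by linarith, by linarith⟩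

/-- Layer cake: g + M takes values in [0, 2M], and each superlevel set has measures differing by at
most half of `tvDist`. The interval length 2M absorbs that half, so the constant is M. -/
theorem abs_integral_sub_le_tvDist {S : Type*} [MeasurableSpace S] (μ ν : Measure S)
    [IsProbabilityMeasure μ] [IsProbabilityMeasure ν] {g : S → ℝ} (hg : Measurable g) {M : ℝ}
    (hM : ∀ x, |g x| ≤ M) : |∫ x, g x ∂μ - ∫ x, g x ∂ν| ≤ M * tvDist μ ν := by
  have hM0 : 0 ≤ M := by
    obtain ⟨x⟩ := nonempty_of_isProbabilityMeasure μ
    exact (abs_nonneg _).trans (hM x)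
  have hint (ρ : Measure S) [IsProbabilityMeasure ρ] : Integrable g ρ :=
    Integrable.of_bound hg.aestronglyMeasurable M (.of_forall hM)
  have key (ρ : Measure S) [IsProbabilityMeasure ρ] :
      ∫ x, g x ∂ρ = (∫ t in Set.Ioc 0 (2 * M), ρ.real {x | t ≤ g x + M}) - M := by
    rw [← Integrable.integral_eq_integral_Ioc_meas_le (f := fun x => g x + M)
      ((hint ρ).add (integrable_const M))
      (.of_forall fun x => by have := (abs_le.1 (hM x)).1; simp; linarith)
      (.of_forall fun x => by have := (abs_le.1 (hM x)).2; simp; linarith),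
      integral_add (hint ρ) (integrable_const M)]
    simp
  have hI (ρ : Measure S) [IsProbabilityMeasure ρ] :
      IntegrableOn (fun t => ρ.real {x | t ≤ g x + M}) (Set.Ioc 0 (2 * M)) := by
    have hanti : Antitone fun t => ρ.real {x | t ≤ g x + M} := fun s t hst =>
      measureReal_mono fun x (hx : t ≤ g x + M) => hst.trans hx
    exact Integrable.of_bound hanti.measurable.aestronglyMeasurable 1
      (.of_forall fun t => by
        rw [Real.norm_eq_abs, abs_of_nonneg measureReal_nonneg]; exact measureReal_le_one)
  rw [key μ, key ν, sub_sub_sub_cancel_right, ← integral_sub (hI μ) (hI ν)]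
  have h := norm_setIntegral_le_of_norm_le_const (μ := volume) (s := Set.Ioc 0 (2 * M))
    (f := fun t => μ.real {x | t ≤ g x + M} - ν.real {x | t ≤ g x + M}) (C := tvDist μ ν / 2)
    measure_Ioc_lt_top (fun t _ => by
      have := abs_real_sub_le_tvDist μ ν (measurableSet_le measurable_const (hg.add_const M) :
        MeasurableSet {x | t ≤ g x + M})
      rw [Real.norm_eq_abs]; linarith)
  refine h.trans (le_of_eq ?_)
  rw [Real.volume_real_Ioc_of_le (by linarith)]
  ring

theorem ofReal_abs_integral_sub_le_wasserstein1 {S : Type*} [MetricSpace S] [MeasurableSpace S]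
    [OpensMeasurableSpace S] (μ ν : Measure S) [IsProbabilityMeasure μ] [IsProbabilityMeasure ν]
    {f : S → ℝ} {L M : ℝ} (hL : 0 ≤ L) (hf : ∀ x y, |f x - f y| ≤ L * dist x y)
    (hM : ∀ x, |f x| ≤ M) :
    ENNReal.ofReal |∫ x, f x ∂μ - ∫ x, f x ∂ν| ≤ ENNReal.ofReal L * wasserstein1 μ ν := by
  rcases hL.eq_or_lt with rfl | hL
  -- L = 0 is separate because the test function below is f / L; here f is constant, and the right
  -- side is 0 even if the distance is ∞.
  · obtain ⟨x₀⟩ := nonempty_of_isProbabilityMeasure μ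
    have hconst : f = fun _ => f x₀ := by
      ext x
      have := hf x x₀
      rw [zero_mul] at this
      exact sub_eq_zero.1 (abs_nonpos_iff.1 this)
    rw [hconst]
    simp
  have key (s : ℝ) (hs : |s| = 1) :
      ENNReal.ofReal (s * (∫ x, f x ∂μ - ∫ x, f x ∂ν)) ≤
        ENNReal.ofReal L * wasserstein1 μ ν := by
    have hlip : LipschitzWith 1 fun x => s / L * f x := by
      refine LipschitzWith.of_dist_le_mul fun x y => ?_
      rw [Real.dist_eq, ← mul_sub, abs_mul, abs_div, hs, abs_of_pos hL, NNReal.coe_one, one_mul,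
        one_div, inv_mul_le_iff₀ hL]
      exact hf x y
    have hint (ρ : Measure S) [IsProbabilityMeasure ρ] : Integrable (fun x => s / L * f x) ρ := by
      refine Integrable.of_bound hlip.continuous.measurable.aestronglyMeasurable (|s / L| * M)
        (.of_forall fun x => ?_)
      rw [Real.norm_eq_abs, abs_mul]
      exact mul_le_mul_of_nonneg_left (hM x) (abs_nonneg _)
    have h := le_iSup (fun f : {f : S → ℝ // LipschitzWith 1 f ∧ Integrable f μ ∧ Integrable f ν} =>
      ENNReal.ofReal (∫ x, f.1 x ∂μ - ∫ x, f.1 x ∂ν)) ⟨_, hlip, hint μ, hint ν⟩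
    refine le_trans (le_of_eq ?_) (mul_le_mul_right h (ENNReal.ofReal L))
    simp only [integral_const_mul]
    rw [← ENNReal.ofReal_mul hL.le]
    congr 1
    field_simp
  rcases abs_choice (∫ x, f x ∂μ - ∫ x, f x ∂ν) with h | h <;> rw [h]
  · simpa using key 1 (by simp)
  · simpa using key (-1) (by simp)

/-! ### The filter is the conditional law of the state -/

namespace POMDP

variable {X Y U : Type*} [MetricSpace X] [MeasurableSpace X]
  [Finite Y] [MeasurableSpace Y] [MeasurableSingletonClass Y]
  [Finite U] [TopologicalSpace U] [MeasurableSpace U] [MeasurableSingletonClass U]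
  (P : POMDP X Y U)

theorem toMeasure_obsPMF (z : ProbabilityMeasure X) (u : U) :
    (P.obsPMF z u).toMeasure = P.Q ∘ₘ (P.predict z u : Measure X) :=
  Measure.toPMF_toMeasure _

theorem lintegral_predict (z : ProbabilityMeasure X) (u : U) {f : X → ℝ≥0∞} (hf : Measurable f) :
    ∫⁻ x, f x ∂(P.predict z u : Measure X) = ∫⁻ x, ∫⁻ x', f x' ∂P.T (x, u) ∂(z : Measure X) := by
  change ∫⁻ x, f x ∂((P.T.sectL u) ∘ₘ (z : Measure X)) = _
  rw [Measure.lintegral_bind (Kernel.aemeasurable _) hf.aemeasurable]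
  simp only [Kernel.sectL_apply]

theorem lintegral_law_succ_eq_step (μ : ProbabilityMeasure X) (γ : Policy Y U) (n : ℕ)
    {f : X × Hist Y U (n + 1) → ℝ≥0∞} (hf : Measurable f) :
    ∫⁻ p, f p ∂P.law μ γ (n + 1) = ∫⁻ p, ∫⁻ x, ∫⁻ y, f (x, Hist.snoc p.2 (γ n p.2) y)
      ∂P.Q x ∂P.T (p.1, γ n p.2) ∂P.law μ γ n := by
  have hm : Measurable fun p : (X × Hist Y U n) × X × Y =>
      (p.2.1, Hist.snoc p.1.2 (γ n p.1.2) p.2.2) := by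
    refine (measurable_fst.comp measurable_snd).prodMk ?_
    exact (measurable_of_finite
      (fun q : Hist Y U n × Y => Hist.snoc q.1 (γ n q.1) q.2)).comp
      ((measurable_snd.comp measurable_fst).prodMk (measurable_snd.comp measurable_snd))
  have hfm : Measurable fun p : (X × Hist Y U n) × X × Y =>
      f (p.2.1, Hist.snoc p.1.2 (γ n p.1.2) p.2.2) := hf.comp hm
  rw [law, lintegral_map hf hm, Measure.lintegral_compProd hfm]
  refine lintegral_congr fun p => ?_
  have hp : Measurable fun q : X × Y => f (q.1, Hist.snoc p.2 (γ n p.2) q.2) :=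
    hfm.comp measurable_prodMk_left
  rw [step, Kernel.lintegral_compProd _ _ _ hp]
  simp only [Kernel.comap_apply, Kernel.prodMkLeft_apply]

variable [StandardBorelSpace X] [Nonempty X]

/-- Bayes' formula. -/
theorem lintegral_update (z : ProbabilityMeasure X) {f : X × Y → ℝ≥0∞} (hf : Measurable f) :
    ∫⁻ x, ∫⁻ y, f (x, y) ∂P.Q x ∂(z : Measure X) =
      ∫⁻ y, ∫⁻ x, f (x, y) ∂(P.update z y : Measure X) ∂(P.Q ∘ₘ (z : Measure X)) := by
  rw [← Measure.lintegral_compProd hf]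
  have h := Measure.lintegral_compProd (μ := P.Q ∘ₘ (z : Measure X))
    (κ := posterior P.Q (z : Measure X)) (hf.comp measurable_swap)
  rw [compProd_posterior_eq_map_swap, lintegral_map (hf.comp measurable_swap) measurable_swap] at h
  exact h

theorem predictor_succ {n : ℕ} (z : ProbabilityMeasure X) (y : Fin (n + 1) → Y)
    (u : Fin (n + 1) → U) :
    P.predictor z (n + 1) y u =
      P.predict (P.update (P.predictor z n (Fin.init y) (Fin.init u)) (y (Fin.last n)))
        (u (Fin.last n)) := rfl

theorem filter_snoc (z : ProbabilityMeasure X) {n : ℕ} (h : Hist Y U n) (u : U) (y : Y) :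
    P.filter z (h.snoc u y) = P.update (P.predict (P.filter z h) u) y := by
  simp [filter, Hist.snoc, predictor_succ]

/-- The law of `X_{n+1}` and of the information at time `n + 1` in terms of the filter at
time `n`. -/
theorem lintegral_step_filter (z : ProbabilityMeasure X) {n : ℕ} (h : Hist Y U n) (u : U)
    {f : X × Hist Y U (n + 1) → ℝ≥0∞} (hf : Measurable f) :
    ∫⁻ x, ∫⁻ x', ∫⁻ y, f (x', h.snoc u y) ∂P.Q x' ∂P.T (x, u) ∂(P.filter z h : Measure X) =
      ∫⁻ y, ∫⁻ x, f (x, h.snoc u y) ∂(P.filter z (h.snoc u y) : Measure X)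
        ∂(P.obsPMF (P.filter z h) u).toMeasure := by
  have hm : Measurable fun p : X × Y => f (p.1, h.snoc u p.2) :=
    hf.comp (measurable_fst.prodMk
      ((measurable_of_finite fun y : Y => h.snoc u y).comp measurable_snd))
  rw [← P.lintegral_predict _ u (Measurable.lintegral_kernel_prod_right' hm),
    P.lintegral_update _ hm, toMeasure_obsPMF]
  simp only [filter_snoc]

/-- Averaging over the hidden state with the filter does not change integrals under the joint law,
i.e. the filter is a conditional law of X_n given the information. Bayes' formula gives time 0 and
propagates the property through each prediction and update. -/
theorem lintegral_law_filter (z : ProbabilityMeasure X) (γ : Policy Y U) (n : ℕ)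
    {f : X × Hist Y U n → ℝ≥0∞} (hf : Measurable f) :
    ∫⁻ p, f p ∂P.law z γ n =
      ∫⁻ p, ∫⁻ x, f (x, p.2) ∂(P.filter z p.2 : Measure X) ∂P.law z γ n := by
  have hmeas {n : ℕ} (g : Hist Y U n → ℝ≥0∞) : Measurable fun p : X × Hist Y U n => g p.2 :=
    (measurable_of_finite g).comp measurable_snd
  induction n with
  | zero =>
    have hm : Measurable fun p : X × Y => (p.1, ((fun _ => p.2, Fin.elim0) : Hist Y U 0)) :=
      measurable_fst.prodMk
        ((measurable_of_finite fun y : Y => ((fun _ => y, Fin.elim0) : Hist Y U 0)).comp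
          measurable_snd)
    have hF := hmeas fun h : Hist Y U 0 => ∫⁻ x, f (x, h) ∂(P.filter z h : Measure X)
    have h1 : Measurable fun p : X × Y => f (p.1, (fun _ => p.2, Fin.elim0)) := hf.comp hm
    have h2 : Measurable fun p : X × Y => ∫⁻ x, f (x, (fun _ => p.2, Fin.elim0))
        ∂(P.filter z ((fun _ => p.2, Fin.elim0) : Hist Y U 0) : Measure X) := hF.comp hm
    rw [law, lintegral_map hf hm, lintegral_map hF hm, Measure.lintegral_compProd h1,
      Measure.lintegral_compProd h2, P.lintegral_update z h1, P.lintegral_update z h2]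
    refine lintegral_congr fun y => ?_
    simp [filter, predictor]
  | succ n ih =>
    -- The right side sees g only through its filter averages, so f and its own filter average give
    -- the same value.
    have key (g : X × Hist Y U (n + 1) → ℝ≥0∞) (hg : Measurable g) :
        ∫⁻ p, g p ∂P.law z γ (n + 1) = ∫⁻ p, ∫⁻ y, ∫⁻ x, g (x, p.2.snoc (γ n p.2) y)
          ∂(P.filter z (p.2.snoc (γ n p.2) y) : Measure X)
          ∂(P.obsPMF (P.filter z p.2) (γ n p.2)).toMeasure ∂P.law z γ n := by
      have hG : Measurable fun p : X × Hist Y U n =>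
          ∫⁻ x, ∫⁻ y, g (x, p.2.snoc (γ n p.2) y) ∂P.Q x ∂P.T (p.1, γ n p.2) := by
        refine measurable_from_prod_countable_left fun h => ?_
        have hm : Measurable fun p : X × Y => g (p.1, h.snoc (γ n h) p.2) :=
          hg.comp (measurable_fst.prodMk
            ((measurable_of_finite fun y : Y => h.snoc (γ n h) y).comp measurable_snd))
        exact (Measurable.lintegral_kernel
          (Measurable.lintegral_kernel_prod_right' (κ := P.Q) hm)).comp
            (measurable_prodMk_right (y := γ n h))
      rw [P.lintegral_law_succ_eq_step z γ n hg, ih hG]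
      exact lintegral_congr fun p => P.lintegral_step_filter z p.2 (γ n p.2) hg
    rw [key f hf, key _ (hmeas fun h => ∫⁻ x, f (x, h) ∂(P.filter z h : Measure X))]
    simp

/-- Given the information at time `n`, the next observation has the law `obsPMF` of the filter. -/
theorem lintegral_law_succ (z : ProbabilityMeasure X) (γ : Policy Y U) (n : ℕ)
    (F : Hist Y U (n + 1) → ℝ≥0∞) :
    ∫⁻ p, F p.2 ∂P.law z γ (n + 1) = ∫⁻ p, ∫⁻ y, F (p.2.snoc (γ n p.2) y)
      ∂(P.obsPMF (P.filter z p.2) (γ n p.2)).toMeasure ∂P.law z γ n := by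
  have hF : Measurable fun p : X × Hist Y U (n + 1) => F p.2 :=
    (measurable_of_finite F).comp measurable_snd
  have hG : Measurable fun p : X × Hist Y U n =>
      ∫⁻ x, ∫⁻ y, F (p.2.snoc (γ n p.2) y) ∂P.Q x ∂P.T (p.1, γ n p.2) := by
    refine measurable_from_prod_countable_left fun h => ?_
    exact (Measurable.lintegral_kernel (Measurable.lintegral_kernel
      (measurable_of_finite fun y : Y => F (h.snoc (γ n h) y)))).comp
        (measurable_prodMk_right (y := γ n h))
  rw [P.lintegral_law_succ_eq_step z γ n hF, P.lintegral_law_filter z γ n hG]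
  refine lintegral_congr fun p => ?_
  exact (P.lintegral_step_filter z p.2 (γ n p.2) hF).trans (by simp)

/-- The law at time `n` depends on the policy only before time `n`. -/
theorem law_congr (z : ProbabilityMeasure X) {γ γ' : Policy Y U} {n : ℕ}
    (h : ∀ k < n, γ k = γ' k) : P.law z γ n = P.law z γ' n := by
  induction n with
  | zero => rfl
  | succ n ih =>
    have hs : P.step γ n = P.step γ' n := by
      simp only [step, h n n.lt_succ_self]
    simp only [law, ih fun k hk => h k (hk.trans n.lt_succ_self), hs, h n n.lt_succ_self]

end POMDP

/-- Transport a history along an equality of lengths. -/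
def Hist.cast {Y U : Type*} {m n : ℕ} (e : m = n) (h : Hist Y U m) : Hist Y U n :=
  (fun i => h.1 (Fin.cast (by rw [e]) i), fun i => h.2 (Fin.cast e.symm i))

namespace POMDP

variable {X Y U : Type*} [MetricSpace X] [MeasurableSpace X]
  [Finite Y] [MeasurableSpace Y] [MeasurableSingletonClass Y]
  [Finite U] [TopologicalSpace U] [MeasurableSpace U] [MeasurableSingletonClass U]
  (P : POMDP X Y U)

theorem lintegral_law_cast (z : ProbabilityMeasure X) (γ : Policy Y U) {m n : ℕ} (e : m = n)
    (F : Hist Y U n → ℝ≥0∞) :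
    ∫⁻ p, F (p.2.cast e) ∂P.law z γ m = ∫⁻ p, F p.2 ∂P.law z γ n := by
  subst e
  rfl

/-! ### One-step estimates -/

theorem _root_.MeasureTheory.Measure.integral_bind_kernel {A B : Type*} [MeasurableSpace A]
    [MeasurableSpace B] {μ : Measure A} [SFinite μ] {κ : Kernel A B} [IsSFiniteKernel κ]
    {f : B → ℝ} (hf : Integrable f (κ ∘ₘ μ)) :
    ∫ b, f b ∂(κ ∘ₘ μ) = ∫ a, ∫ b, f b ∂κ a ∂μ := by
  have h : Integrable (fun p : A × B => f p.2) (μ ⊗ₘ κ) := by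
    rw [← Measure.snd_compProd] at hf
    exact hf.comp_measurable measurable_snd
  rw [← Measure.snd_compProd, Measure.snd,
    integral_map measurable_snd.aemeasurable (by
      rw [← Measure.snd, Measure.snd_compProd]; exact hf.aestronglyMeasurable),
    Measure.integral_compProd h]


theorem expect_obsPMF (z : ProbabilityMeasure X) (u : U) (F : Y → ℝ) {M : ℝ}
    (hF : ∀ y, |F y| ≤ M) :
    (P.obsPMF z u).expect F = ∫ x, ∫ x', ∫ y, F y ∂P.Q x' ∂P.T (x, u) ∂(z : Measure X) := by
  have hFm : Measurable F := measurable_of_finite F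
  have h1 : (P.obsPMF z u).expect F = ∫ y, F y ∂(P.obsPMF z u).toMeasure :=
    (PMF.integral_eq_tsum _ F
      (Integrable.of_bound hFm.aestronglyMeasurable M (.of_forall hF))).symm
  have hint : Integrable F (P.Q ∘ₘ (P.predict z u : Measure X)) :=
    Integrable.of_bound hFm.aestronglyMeasurable M (.of_forall hF)
  have hGm : StronglyMeasurable fun x' => ∫ y, F y ∂P.Q x' :=
    hFm.stronglyMeasurable.integral_kernel
  have hint' : Integrable (fun x' => ∫ y, F y ∂P.Q x') (P.T.sectL u ∘ₘ (z : Measure X)) := by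
    refine Integrable.of_bound hGm.aestronglyMeasurable M (.of_forall fun x' => ?_)
    simpa using norm_integral_le_of_norm_le_const (μ := P.Q x') (f := F) (.of_forall hF)
  rw [h1, toMeasure_obsPMF, MeasureTheory.Measure.integral_bind_kernel hint]
  change ∫ x', ∫ y, F y ∂P.Q x' ∂(P.T.sectL u ∘ₘ (z : Measure X)) = _
  rw [MeasureTheory.Measure.integral_bind_kernel hint']
  simp only [Kernel.sectL_apply]

/-- Averaging F over the channel gives a function bounded by M but possibly irregular in x'.
Integrating it against T(· | x, u) makes it αM-Lipschitz in x, by the total variation bound, and W₁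
then compares the two priors. -/
theorem ofReal_abs_expect_obsPMF_sub_le [OpensMeasurableSpace X] {α : ℝ} (hα : 0 ≤ α)
    (hT : ∀ (x x' : X) (u : U), tvDist (P.T (x, u)) (P.T (x', u)) ≤ α * dist x x')
    (z z' : ProbabilityMeasure X) (u : U) {F : Y → ℝ} {M : ℝ} (hM : 0 ≤ M)
    (hF : ∀ y, |F y| ≤ M) :
    ENNReal.ofReal |(P.obsPMF z u).expect F - (P.obsPMF z' u).expect F| ≤
      ENNReal.ofReal (α * M) * wasserstein1 (z : Measure X) (z' : Measure X) := by
  have hGm : Measurable fun x' => ∫ y, F y ∂P.Q x' :=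
    (measurable_of_finite F).stronglyMeasurable.integral_kernel.measurable
  have hG : ∀ x', |∫ y, F y ∂P.Q x'| ≤ M := fun x' => by
    simpa using norm_integral_le_of_norm_le_const (μ := P.Q x') (f := F) (.of_forall hF)
  rw [P.expect_obsPMF z u F hF, P.expect_obsPMF z' u F hF]
  refine ofReal_abs_integral_sub_le_wasserstein1 (M := M) _ _ (mul_nonneg hα hM)
    (fun x x' => ?_) fun x => ?_
  · refine (abs_integral_sub_le_tvDist _ _ hGm hG).trans ?_
    refine (mul_le_mul_of_nonneg_left (hT x x' u) hM).trans (le_of_eq (by ring))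
  · simpa using norm_integral_le_of_norm_le_const (μ := P.T (x, u))
      (f := fun x' => ∫ y, F y ∂P.Q x') (.of_forall hG)

theorem ofReal_expect_obsPMF (z : ProbabilityMeasure X) (u : U) {F : Y → ℝ} {M : ℝ}
    (hF0 : ∀ y, 0 ≤ F y) (hF : ∀ y, |F y| ≤ M) :
    ENNReal.ofReal ((P.obsPMF z u).expect F) =
      ∫⁻ y, ENNReal.ofReal (F y) ∂(P.obsPMF z u).toMeasure := by
  have hint : Integrable F (P.obsPMF z u).toMeasure :=
    Integrable.of_bound (measurable_of_finite F).aestronglyMeasurable M (.of_forall hF)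
  rw [← ofReal_integral_eq_lintegral_ofReal hint (.of_forall hF0)]
  exact congrArg ENNReal.ofReal (PMF.integral_eq_tsum _ F hint).symm

variable [StandardBorelSpace X] [Nonempty X]

theorem abs_windowMDP_cost_le (N : ℕ) (s : ProbabilityMeasure X × Hist Y U N) (u : U) :
    |(P.windowMDP N).cost s u| ≤ ‖P.c‖ := by
  have h := norm_integral_le_of_norm_le_const (μ := (P.filter s.1 s.2 : Measure X))
    (f := fun x => P.c (x, u)) (.of_forall fun x => P.c.norm_coe_le_norm (x, u))
  rw [probReal_univ, mul_one] at h
  exact h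

theorem abs_Jstar_le [Nonempty U] {β : ℝ} (hβ0 : 0 ≤ β) (hβ1 : β < 1) {N : ℕ}
    (s : ProbabilityMeasure X × Hist Y U N) : |P.Jstar β s| ≤ ‖P.c‖ / (1 - β) :=
  MDP.abs_value_le _ hβ0 hβ1 (P.abs_windowMDP_cost_le N) s

theorem abs_Jtilde_le [Nonempty U] {β : ℝ} (hβ0 : 0 ≤ β) (hβ1 : β < 1)
    (zstar : ProbabilityMeasure X) {N : ℕ} (s : ProbabilityMeasure X × Hist Y U N) :
    |P.Jtilde β zstar s| ≤ ‖P.c‖ / (1 - β) :=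
  MDP.abs_value_le (P.approxMDP zstar N) hβ0 hβ1 (fun _ => P.abs_windowMDP_cost_le N _) s.2

theorem Jstar_eq_iInf [Nonempty U] {β : ℝ} (hβ0 : 0 ≤ β) (hβ1 : β < 1) {N : ℕ}
    (s : ProbabilityMeasure X × Hist Y U N) :
    P.Jstar β s = ⨅ u, ((P.windowMDP N).cost s u +
      β * (P.obsPMF (P.filter s.1 s.2) u).expect fun y => P.Jstar β (P.nextState s u y)) := by
  refine (MDP.value_eq_iInf _ hβ0 hβ1 (P.abs_windowMDP_cost_le N) s).trans ?_
  refine iInf_congr fun u => ?_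
  rw [MDP.actionValue]
  congr 2
  exact PMF.expect_map _ _ (P.abs_Jstar_le hβ0 hβ1)

/-- The successor is written from s rather than from (`zstar`, s.2): the shifted window is the same
and `Jtilde` reads nothing else. This puts both Bellman equations on the same successor states. -/
theorem Jtilde_eq_iInf [Nonempty U] {β : ℝ} (hβ0 : 0 ≤ β) (hβ1 : β < 1)
    (zstar : ProbabilityMeasure X) {N : ℕ} (s : ProbabilityMeasure X × Hist Y U N) :
    P.Jtilde β zstar s = ⨅ u, ((P.windowMDP N).cost (zstar, s.2) u +
      β * (P.obsPMF (P.filter zstar s.2) u).expect fun y =>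
        P.Jtilde β zstar (P.nextState s u y)) := by
  have hb : ∀ I : Hist Y U N, |(P.approxMDP zstar N).value β I| ≤ ‖P.c‖ / (1 - β) := fun I =>
    P.abs_Jtilde_le hβ0 hβ1 zstar (zstar, I)
  refine (MDP.value_eq_iInf (P.approxMDP zstar N) hβ0 hβ1
    (fun _ => P.abs_windowMDP_cost_le N _) s.2).trans ?_
  refine iInf_congr fun u => ?_
  rw [MDP.actionValue]
  congr 2
  exact (PMF.expect_map _ _ hb).trans (PMF.expect_map _ _ fun t => hb t.2)

theorem exists_ofReal_abs_Jtilde_sub_Jstar_le [OpensMeasurableSpace X] [Nonempty U] {β : ℝ}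
    (hβ0 : 0 ≤ β) (hβ1 : β < 1) {α : ℝ} (hα : 0 ≤ α)
    (hT : ∀ (x x' : X) (u : U), tvDist (P.T (x, u)) (P.T (x', u)) ≤ α * dist x x')
    {K₁ : ℝ} (hK₁ : 0 ≤ K₁)
    (hc : ∀ (x x' : X) (u : U), |P.c (x, u) - P.c (x', u)| ≤ K₁ * dist x x')
    (zstar : ProbabilityMeasure X) {N : ℕ} (s : ProbabilityMeasure X × Hist Y U N) :
    ∃ u, ENNReal.ofReal |P.Jtilde β zstar s - P.Jstar β s| ≤
      ENNReal.ofReal (K₁ + α * β * (‖P.c‖ / (1 - β))) *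
        wasserstein1 (P.filter s.1 s.2 : Measure X) (P.filter zstar s.2 : Measure X) +
      ENNReal.ofReal β * ∫⁻ y, ENNReal.ofReal
        |P.Jtilde β zstar (P.nextState s u y) - P.Jstar β (P.nextState s u y)|
          ∂(P.obsPMF (P.filter s.1 s.2) u).toMeasure := by
  set M := ‖P.c‖ / (1 - β) with hMdef
  have hM : 0 ≤ M := div_nonneg (norm_nonneg _) (by linarith)
  have hJs := P.abs_Jstar_le hβ0 hβ1 (N := N)
  have hJt := P.abs_Jtilde_le hβ0 hβ1 zstar (N := N)
  rw [P.Jtilde_eq_iInf hβ0 hβ1, P.Jstar_eq_iInf hβ0 hβ1]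
  obtain ⟨u, hu⟩ := exists_abs_ciInf_sub_ciInf_le
    (fun u => (P.windowMDP N).cost (zstar, s.2) u +
      β * (P.obsPMF (P.filter zstar s.2) u).expect fun y =>
        P.Jtilde β zstar (P.nextState s u y))
    (fun u => (P.windowMDP N).cost s u +
      β * (P.obsPMF (P.filter s.1 s.2) u).expect fun y => P.Jstar β (P.nextState s u y))
  refine ⟨u, (ENNReal.ofReal_le_ofReal hu).trans ?_⟩
  set F : Y → ℝ := fun y => P.Jtilde β zstar (P.nextState s u y)
  set G : Y → ℝ := fun y => P.Jstar β (P.nextState s u y)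
  have hF : ∀ y, |F y| ≤ M := fun y => hJt _
  have hG : ∀ y, |G y| ≤ M := fun y => hJs _
  have hFG : ∀ y, |F y - G y| ≤ M + M := fun y =>
    (abs_sub _ _).trans (add_le_add (hF y) (hG y))
  have hFG' : ∀ y, |(|F y - G y|)| ≤ M + M := fun y => by rw [abs_abs]; exact hFG y
  set p := P.obsPMF (P.filter s.1 s.2) u
  set q := P.obsPMF (P.filter zstar s.2) u
  have hexp : |p.expect F - p.expect G| ≤ p.expect fun y => |F y - G y| := by
    rw [← p.expect_sub hF hG]
    refine abs_le.2 ⟨?_, p.expect_mono hFG hFG' fun y => le_abs_self _⟩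
    have h := p.expect_mono (f := fun y => -1 * |F y - G y|) (g := fun y => F y - G y)
      (C := M + M) (fun y => by rw [neg_one_mul, abs_neg]; exact hFG' y) hFG
      fun y => by rw [neg_one_mul]; exact neg_abs_le _
    rwa [p.expect_const_mul, neg_one_mul] at h
  -- The law is switched from q to p on F, the continuation of `Jtilde`, so that F - G is averaged
  -- under the true law p.
  have hreal : |(P.windowMDP N).cost (zstar, s.2) u + β * q.expect F -
      ((P.windowMDP N).cost s u + β * p.expect G)| ≤
      (|(P.windowMDP N).cost s u - (P.windowMDP N).cost (zstar, s.2) u| +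
        β * |p.expect F - q.expect F|) + β * p.expect fun y => |F y - G y| := by
    have e : (P.windowMDP N).cost (zstar, s.2) u + β * q.expect F -
        ((P.windowMDP N).cost s u + β * p.expect G) =
        (-((P.windowMDP N).cost s u - (P.windowMDP N).cost (zstar, s.2) u) +
          β * -(p.expect F - q.expect F)) + β * (p.expect F - p.expect G) := by ring
    rw [e]
    refine (abs_add_le _ _).trans (add_le_add ((abs_add_le _ _).trans (le_of_eq ?_)) ?_)
    · rw [abs_mul, abs_neg, abs_neg, abs_of_nonneg hβ0]
    · rw [abs_mul, abs_of_nonneg hβ0]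
      exact mul_le_mul_of_nonneg_left hexp hβ0
  have hpos : 0 ≤ p.expect fun y => |F y - G y| := (abs_nonneg _).trans hexp
  refine (ENNReal.ofReal_le_ofReal hreal).trans ?_
  rw [ENNReal.ofReal_add (by positivity) (by positivity), ENNReal.ofReal_mul hβ0,
    P.ofReal_expect_obsPMF _ _ (fun y => abs_nonneg _) hFG']
  refine add_le_add_left ?_ _
  rw [ENNReal.ofReal_add (abs_nonneg _) (by positivity), ENNReal.ofReal_mul hβ0,
    ENNReal.ofReal_add hK₁ (by positivity), add_mul]
  refine add_le_add ?_ ?_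
  · exact ofReal_abs_integral_sub_le_wasserstein1 _ _ hK₁ (fun x x' => hc x x' u)
      fun x => P.c.norm_coe_le_norm (x, u)
  · rw [mul_right_comm, mul_comm _ β, ENNReal.ofReal_mul hβ0, mul_assoc]
    exact mul_le_mul_right (P.ofReal_abs_expect_obsPMF_sub_le hα hT _ _ u hM hF) _

/-! ### Filters and windows -/

theorem predictor_add (z : ProbabilityMeasure X) (t N : ℕ) (y : Fin (t + N) → Y)
    (u : Fin (t + N) → U) :
    P.predictor z (t + N) y u =
      P.predictor (P.predictor z t (fun i => y (Fin.castAdd N i)) fun i => u (Fin.castAdd N i)) N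
        (fun i => y (Fin.natAdd t i)) fun i => u (Fin.natAdd t i) := by
  induction N with
  | zero => rfl
  | succ N ih =>
    change P.predictor z (t + N + 1) y u = _
    rw [predictor_succ, predictor_succ, ih]
    rfl

/-- The predictor z_t^- carries all that the first t observations and actions contribute, so the
reduction itself is exact; only replacing z_t^- by `zstar` introduces an error. -/
theorem filter_zhat (z : ProbabilityMeasure X) {t N : ℕ} (h : Hist Y U (t + N)) :
    P.filter (P.zhat z h).1 (P.zhat z h).2 = P.filter z h := by
  change _ = P.update (P.predictor z (t + N) (Fin.init h.1) h.2) _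
  rw [predictor_add]
  rfl

theorem zhat_cast (z : ProbabilityMeasure X) {t t' N : ℕ} (e : t + N = t' + N)
    (h : Hist Y U (t + N)) : P.zhat z (h.cast e) = P.zhat z h := by
  obtain rfl : t = t' := by omega
  rfl

theorem zhat_zero (z : ProbabilityMeasure X) {N : ℕ} (e : 0 + N = N) (h : Hist Y U (0 + N)) :
    P.zhat z h = (z, h.cast e) := by
  refine Prod.ext rfl (Prod.ext ?_ ?_) <;> ext i
  · exact congrArg h.1 (Fin.ext (Nat.zero_add _))
  · exact congrArg h.2 (Fin.ext (Nat.zero_add _))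

theorem snoc_natAdd {A : Type*} {t n : ℕ} (f : Fin (t + n) → A) (a : A) (i : Fin (n + 1)) :
    (Fin.snoc (fun i => f (Fin.natAdd t i)) a : Fin (n + 1) → A) i =
      (Fin.snoc f a : Fin (t + n + 1) → A) (Fin.natAdd t i) := by
  refine Fin.lastCases ?_ (fun i => ?_) i
  · rw [Fin.snoc_last]
    exact (Fin.snoc_last (α := fun _ => A) a f).symm
  · rw [Fin.snoc_castSucc]
    exact (Fin.snoc_castSucc (α := fun _ => A) a f (Fin.natAdd t i)).symm

/-- The oldest observation and action leave the window and enter the predictor. The cast reconciles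
t + N + 1 with t + 1 + N, which are not definitionally equal. -/
theorem zhat_snoc (z : ProbabilityMeasure X) {t N : ℕ} (h : Hist Y U (t + N)) (u : U) (y : Y)
    (e : t + N + 1 = t + 1 + N) :
    P.zhat z ((h.snoc u y).cast e) = P.nextState (P.zhat z h) u y := by
  have hw : Hist.snoc (window h) u y =
      ((fun i => (h.snoc u y).1 (Fin.natAdd t i), fun i => (h.snoc u y).2 (Fin.natAdd t i)) :
        Hist Y U (N + 1)) :=
    Prod.ext (funext (snoc_natAdd (n := N + 1) h.1 y)) (funext (snoc_natAdd (n := N) h.2 u))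
  have h1 (i : Fin (t + N + 1)) : (h.snoc u y).1 i.castSucc = h.1 i :=
    Fin.snoc_castSucc (α := fun _ => Y) _ _ i
  have h2 (i : Fin (t + N)) : (h.snoc u y).2 i.castSucc = h.2 i :=
    Fin.snoc_castSucc (α := fun _ => U) _ _ i
  rw [nextState]
  simp only [zhat, hw]
  refine Prod.ext ?_ (Prod.ext ?_ ?_)
  · simp only [pastPredictor, predictor_succ]
    congr 3
    · ext i
      exact h1 (Fin.castAdd (N + 1) i)
    · ext i
      exact h2 (Fin.castAdd N i)
  · ext i
    exact congrArg (h.snoc u y).1 (Fin.ext (by simp; omega))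
  · ext i
    exact congrArg (h.snoc u y).2 (Fin.ext (by simp; omega))

/-! ### Switching to a policy on the reduced states -/

/-- Follow `γ` before time `N` and from then on apply `g` to the state of the reduction. -/
def switchPolicy (z : ProbabilityMeasure X) (N : ℕ) (γ : Policy Y U)
    (g : ProbabilityMeasure X × Hist Y U N → U) : Policy Y U := fun n h =>
  if hn : N ≤ n then
    g (P.zhat z (t := n - N) (h.cast (Nat.sub_add_cancel hn).symm))
  else γ n h

theorem switchPolicy_add (z : ProbabilityMeasure X) (N : ℕ) (γ : Policy Y U)
    (g : ProbabilityMeasure X × Hist Y U N → U) (t : ℕ) (h : Hist Y U (t + N)) :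
    P.switchPolicy z N γ g (t + N) h = g (P.zhat z h) := by
  rw [switchPolicy, dif_pos (Nat.le_add_left N t), zhat_cast]

theorem switchPolicy_mem (z : ProbabilityMeasure X) (N : ℕ) (γ : Policy Y U)
    (g : ProbabilityMeasure X × Hist Y U N → U) :
    P.switchPolicy z N γ g ∈ P.markovPolicies z N :=
  fun t => ⟨g, P.switchPolicy_add z N γ g t⟩

theorem law_switchPolicy (z : ProbabilityMeasure X) (N : ℕ) (γ : Policy Y U)
    (g : ProbabilityMeasure X × Hist Y U N → U) :
    P.law z (P.switchPolicy z N γ g) N = P.law z γ N :=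
  P.law_congr z fun k hk => by
    ext h
    rw [switchPolicy, dif_neg (not_le.2 hk)]

/-- Under a policy that acts on the states of the reduction, these evolve according to
`nextState`. -/
theorem lintegral_zhat_succ (z : ProbabilityMeasure X) (N : ℕ) (γ : Policy Y U)
    (g : ProbabilityMeasure X × Hist Y U N → U)
    (hγ : ∀ (t : ℕ) (h : Hist Y U (t + N)), γ (t + N) h = g (P.zhat z h)) (t : ℕ)
    (F : ProbabilityMeasure X × Hist Y U N → ℝ≥0∞) :
    ∫⁻ p, F (P.zhat z p.2) ∂P.law z γ (t + 1 + N) =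
      ∫⁻ p, ∫⁻ y, F (P.nextState (P.zhat z p.2) (g (P.zhat z p.2)) y)
        ∂(P.obsPMF (P.filter (P.zhat z p.2).1 (P.zhat z p.2).2) (g (P.zhat z p.2))).toMeasure
        ∂P.law z γ (t + N) := by
  have e : t + N + 1 = t + 1 + N := by omega
  rw [← P.lintegral_law_cast z γ e fun h => F (P.zhat z h),
    P.lintegral_law_succ z γ (t + N) fun h => F (P.zhat z (h.cast e))]
  simp only [zhat_snoc, hγ, filter_zhat]

/-- Integrates a pointwise recursive bound along the process; the one-step mean on the right becomes
the integral at the next time. -/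
theorem lintegral_zhat_le (z : ProbabilityMeasure X) (N : ℕ) (γ : Policy Y U)
    (g : ProbabilityMeasure X × Hist Y U N → U)
    (hγ : ∀ (t : ℕ) (h : Hist Y U (t + N)), γ (t + N) h = g (P.zhat z h))
    {D w : ProbabilityMeasure X × Hist Y U N → ℝ≥0∞} {K b : ℝ≥0∞}
    (hD : ∀ s, D s ≤ K * w s + b * ∫⁻ y, D (P.nextState s (g s) y)
      ∂(P.obsPMF (P.filter s.1 s.2) (g s)).toMeasure) (t : ℕ) :
    ∫⁻ p, D (P.zhat z p.2) ∂P.law z γ (t + N) ≤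
      K * ∫⁻ p, w (P.zhat z p.2) ∂P.law z γ (t + N) +
        b * ∫⁻ p, D (P.zhat z p.2) ∂P.law z γ (t + 1 + N) := by
  have hm (f : Hist Y U (t + N) → ℝ≥0∞) : Measurable fun p : X × Hist Y U (t + N) => f p.2 :=
    (measurable_of_finite f).comp measurable_snd
  have h1 := hm fun h => w (P.zhat z h)
  have h2 := hm fun h => ∫⁻ y, D (P.nextState (P.zhat z h) (g (P.zhat z h)) y)
    ∂(P.obsPMF (P.filter (P.zhat z h).1 (P.zhat z h).2) (g (P.zhat z h))).toMeasure
  rw [P.lintegral_zhat_succ z N γ g hγ t D, ← lintegral_const_mul _ h1,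
    ← lintegral_const_mul _ h2, ← lintegral_add_left (h1.const_mul K)]
  exact lintegral_mono fun p => hD (P.zhat z p.2)

end POMDP

/-! ### Iteration of the recursion and the final bound -/

/-- Iterating a discounted recursive inequality with bounded terms. -/
theorem ENNReal.le_mul_tsum_of_le_add {a w : ℕ → ℝ≥0∞} {K : ℝ≥0∞} {C β : ℝ} (hβ0 : 0 ≤ β)
    (hβ1 : β < 1) (ha : ∀ t, a t ≤ ENNReal.ofReal C)
    (h : ∀ t, a t ≤ K * w t + ENNReal.ofReal β * a (t + 1)) :
    a 0 ≤ K * ∑' t, ENNReal.ofReal (β ^ t) * w t := by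
  have hind (n : ℕ) : a 0 ≤ K * ∑ t ∈ Finset.range n, ENNReal.ofReal (β ^ t) * w t +
      ENNReal.ofReal (β ^ n) * a n := by
    induction n with
    | zero => simp
    | succ n ih =>
      refine ih.trans ((add_le_add_right (mul_le_mul_right (h n) _) _).trans (le_of_eq ?_))
      rw [Finset.sum_range_succ, pow_succ, ENNReal.ofReal_mul (pow_nonneg hβ0 n)]
      ring
  have h0 : Filter.Tendsto (fun n : ℕ => β ^ n * C) Filter.atTop (nhds 0) := by
    simpa using (_root_.tendsto_pow_atTop_nhds_zero_of_lt_one hβ0 hβ1).mul_const C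
  -- The partial sums are replaced by the full series before the limit, so the series may be ∞ and
  -- only the remainder βⁿ C has to converge.
  have hlim : Filter.Tendsto (fun n : ℕ => K * (∑' t, ENNReal.ofReal (β ^ t) * w t) +
      ENNReal.ofReal (β ^ n * C)) Filter.atTop
      (nhds (K * (∑' t, ENNReal.ofReal (β ^ t) * w t) + ENNReal.ofReal 0)) :=
    tendsto_const_nhds.add (ENNReal.tendsto_ofReal h0)
  rw [ENNReal.ofReal_zero, add_zero] at hlim
  refine ge_of_tendsto' hlim fun n => (hind n).trans (add_le_add ?_ ?_)
  · exact mul_le_mul_right (ENNReal.sum_le_tsum _) _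
  · rw [ENNReal.ofReal_mul (pow_nonneg hβ0 n)]
    exact mul_le_mul_right (ha n) _

theorem mainTheorem2 {X Y U : Type*}
    [MetricSpace X] [MeasurableSpace X] [BorelSpace X] [StandardBorelSpace X] [Nonempty X]
    [Finite Y] [MeasurableSpace Y] [MeasurableSingletonClass Y]
    [Finite U] [TopologicalSpace U] [DiscreteTopology U] [MeasurableSpace U]
    [MeasurableSingletonClass U]
    (P : POMDP X Y U) (β : ℝ) (hβ0 : 0 < β) (hβ1 : β < 1)
    (α : ℝ) (hα : 0 ≤ α)
    (hT : ∀ (x x' : X) (u : U), tvDist (P.T (x, u)) (P.T (x', u)) ≤ α * dist x x')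
    (K₁ : ℝ) (hK₁ : 0 ≤ K₁)
    (hc : ∀ (x x' : X) (u : U), |P.c (x, u) - P.c (x', u)| ≤ K₁ * dist x x')
    (N : ℕ) (z₀ zstar : ProbabilityMeasure X) (γ : Policy Y U) :
    ∫⁻ p : X × Hist Y U N,
        ENNReal.ofReal |P.Jtilde β zstar (z₀, p.2) - P.Jstar β (z₀, p.2)| ∂(P.law z₀ γ N)
      ≤ ENNReal.ofReal (K₁ + α * β * (‖P.c‖ / (1 - β))) *
          ∑' t : ℕ, ENNReal.ofReal (β ^ t) * P.Lbar z₀ zstar N t := by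
  -- An observation exists because Q is Markov, and γ must answer it with an action.
  have : Nonempty U := by
    obtain ⟨y⟩ := nonempty_of_isProbabilityMeasure (P.Q (Classical.arbitrary X))
    exact ⟨γ 0 (fun _ => y, Fin.elim0)⟩
  -- g picks, at each reduced state, the action at which the two Bellman minima are compared; it
  -- need not be optimal for either problem.
  choose g hg using P.exists_ofReal_abs_Jtilde_sub_Jstar_le hβ0.le hβ1 hα hT hK₁ hc zstar (N := N)
  set D : ProbabilityMeasure X × Hist Y U N → ℝ≥0∞ := fun s =>
    ENNReal.ofReal |P.Jtilde β zstar s - P.Jstar β s| 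
  have hD : ∀ s, D s ≤ ENNReal.ofReal (‖P.c‖ / (1 - β) + ‖P.c‖ / (1 - β)) := fun s =>
    ENNReal.ofReal_le_ofReal ((abs_sub _ _).trans
      (add_le_add (P.abs_Jtilde_le hβ0.le hβ1 zstar s) (P.abs_Jstar_le hβ0.le hβ1 s)))
  -- The law at time N involves only actions before N, where the switched policy agrees with γ; at t
  -- = 0 the predictor is still z₀.
  have h0 : ∫⁻ p, D (P.zhat z₀ p.2) ∂P.law z₀ (P.switchPolicy z₀ N γ g) (0 + N) =
      ∫⁻ p, D (z₀, p.2) ∂P.law z₀ γ N := by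
    rw [← P.law_switchPolicy z₀ N γ g,
      ← P.lintegral_law_cast z₀ _ (Nat.zero_add N) fun h => D (z₀, h)]
    simp only [P.zhat_zero z₀ (Nat.zero_add N)]
  have hrec := P.lintegral_zhat_le z₀ N (P.switchPolicy z₀ N γ g) g
    (P.switchPolicy_add z₀ N γ g) (D := D) hg
  have hfinal := ENNReal.le_mul_tsum_of_le_add
    (a := fun t => ∫⁻ p, D (P.zhat z₀ p.2) ∂P.law z₀ (P.switchPolicy z₀ N γ g) (t + N))
    (C := ‖P.c‖ / (1 - β) + ‖P.c‖ / (1 - β))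
    hβ0.le hβ1 (fun t => (lintegral_mono fun p => hD _).trans (by simp)) hrec
  rw [h0] at hfinal
  refine hfinal.trans (mul_le_mul_right (ENNReal.tsum_le_tsum fun t => mul_le_mul_right ?_ _) _)
  -- The same policy is a competitor in the supremum for every t.
  exact le_iSup₂_of_le (P.switchPolicy z₀ N γ g) (P.switchPolicy_mem z₀ N γ g) le_rfl

end
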